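/- **Definitions.** A *tight apartness* on a set is a relation $\ne$ such that $\neg(x\ne x)$; $x\ne y$ implies $y\ne x$; $x\ne y$ implies, for every $z$, that $z\ne x$ or $z\ne y$; and $\neg(x\ne y)$ implies $x=y$. A *geometry* $(\mathscr P,\mathscr L)$ is a set $\mathscr P$ of points with a tight apartness $\ne$ ("distinct") and a set $\mathscr L$ of subsets of $\mathscr P$, called lines. Write $P\notin l$ ("$P$ lies outside $l$") if $P\ne Q$ for all $Q\in l$. Lines are *distinct*, $l\ne m$, if some point of one of them lies outside the other; $l\nparallel m$ if $l\ne m$ and $l$, $m$ have a common point; $l\parallel m$ means $\neg(l\nparallel m)$. If $P \neq Q$, the line through $P$ and $Q$ (see G1 below) is denoted $P+Q$. Maps are distinct if their values at some argument are distinct, and pairs are distinct if they are distinct in at least one coordinate. A map is *injective* if it takes distinct elements to distinct elements; a *bijection* is injective and onto, with an injective inverse. A *dilatation* is an injective map $\sigma$ of $\mathscr P$ onto $\mathscr P$ such that $P+Q\parallel\sigma P+\sigma Q$ whenever $P\ne Q$. Its set of *traces* is $t(\sigma)=\{P+\sigma P : P\ne\sigma P\}$. A *translation* is a dilatation any two traces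 of which are parallel. Two translations $\tau_1\ne1$, $\tau_2\ne 1$ have *different directions* if $l\nparallel m$ for some $l\in t(\tau_1)$ and $m\in t(\tau_2)$. A *constructive Desarguesian plane* is a geometry such that: - (G1) two distinct points lie on a unique common line; - (G2) through any point there is a unique line parallel to a given line; - (G3) there are pairwise distinct points $A,B,C$ with $C\notin A+B$; - (L1) if $l\nparallel m$, $P\in l\cap m$ and $Q\ne P$, then $Q\notin l$ or $Q\notin m$; - (L2) if $l\nparallel m$ and $n$ is a line, then $n\nparallel l$ or $n\nparallel m$; - (K1) for any points $P,Q$ there is a translation carrying $P$ to $Q$; - (K2) if $Q,R$ are collinear with $P$ and both distinct from $P$, there is a dilatation $\sigma$ with $\sigma P=P$ and $\sigma Q=R$. In such a plane the translations form a commutative group $T$ under composition, and the translation $\tau_{PQ}$ carrying $P$ to $Q$ is unique. Let $k$ be the set of *trace-preserving homomorphisms*, that is, maps $\alpha:T\to T$, $\tau\mapsto\tau^\alpha$, with $(\tau\rho)^\alpha=\tau^\alpha\rho^\alpha$ and $t(\tau^\alpha)\subseteq t(\tau)$; it is a ring under $\tau^{\alpha+\beta}=\tau^\alpha\tau^\beta$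 and $\tau^{\alpha\beta}=(\tau^\beta)^\alpha$. **Theorem 5.6.** Let $(\mathscr P,\mathscr L)$ be a constructive Desarguesian plane, let $O$ be a point, and let $\tau_1\ne1$ and $\tau_2\ne1$ be translations with different directions. (a) For each point $P$ there is a unique pair $(x,y)\in k^2$ with $\tau_{OP}=\tau_1^x\tau_2^y$. (b) The resulting map $\mathscr P\to k^2$ is a bijection, and points are distinct if and only if their coordinate pairs are distinct. (c) For each line $l$ there are $\alpha,\beta,\gamma,\delta\in k$, with $\gamma\ne0$ or $\delta\ne0$, such that the points on $l$ are exactly the points with coordinates in $$L=\{(\alpha+t\gamma,\ \beta+t\delta): t\in k\}.$$ Conversely, for all $\alpha,\beta,\gamma,\delta\in k$ with $\gamma\ne0$ or $\delta\ne0$, the set of points with coordinates in $L$ is a line in $\mathscr L$. (d) If $l$ is the line whose points are those with coordinates in such a set $L$, and $P$ is a point with coordinates $(x,y)$, then $P\notin l$ if and only if $(x,y)\ne(\alpha+t\gamma,\ \beta+t\delta)$ for all $t\in k$. -/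

import Mathlib

/-!
Planes with a primitive apartness relation on points: lines, parallelism, dilatations,
translations, trace-preserving homomorphisms.  The inequality of points is a primitive
relation, never the negation of equality, and every disjunction and existential below is the
positive one of the constructive definitions.
-/

universe u

/-- A tight apartness relation. -/
class TightApartness (X : Type u) where
  apart : X → X → Prop
  irrefl : ∀ x, ¬ apart x x
  symm : ∀ {x y}, apart x y → apart y x
  cotrans : ∀ {x y}, apart x y → ∀ z, apart z x ∨ apart z y
  tight : ∀ {x y}, ¬ apart x y → x = y

infix:50 " ⋕ " => TightApartness.apart

/-- Inequality of maps: they differ at some argument. -/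
instance TightApartness.onMaps {X Y : Type u} [TightApartness Y] : TightApartness (X → Y) where
  apart f g := ∃ x, f x ⋕ g x
  irrefl f := fun ⟨x, h⟩ => TightApartness.irrefl (f x) h
  symm := fun ⟨x, h⟩ => ⟨x, TightApartness.symm h⟩
  cotrans := fun ⟨x, h⟩ k =>
    (TightApartness.cotrans h (k x)).imp (fun h' => ⟨x, h'⟩) (fun h' => ⟨x, h'⟩)
  tight := fun h => funext fun x => TightApartness.tight fun h' => h ⟨x, h'⟩

/-- Inequality of pairs: they differ in one of the coordinates. -/
instance TightApartness.onProd {X Y : Type u} [TightApartness X] [TightApartness Y] :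
    TightApartness (X × Y) where
  apart p q := p.1 ⋕ q.1 ∨ p.2 ⋕ q.2
  irrefl _ := fun h => h.elim (TightApartness.irrefl _) (TightApartness.irrefl _)
  symm := fun h => h.imp TightApartness.symm TightApartness.symm
  cotrans := fun h r => h.elim
    (fun h => (TightApartness.cotrans h r.1).imp Or.inl Or.inl)
    (fun h => (TightApartness.cotrans h r.2).imp Or.inr Or.inr)
  tight := fun h => Prod.ext (TightApartness.tight fun h' => h (Or.inl h'))
    (TightApartness.tight fun h' => h (Or.inr h'))

/-- A map is (strongly) injective if it carries distinct elements to distinct elements. -/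
def ApartInjective {X Y : Type u} [TightApartness X] [TightApartness Y] (f : X → Y) : Prop :=
  ∀ x y, x ⋕ y → f x ⋕ f y

/-- A bijection is injective and onto, and has an injective inverse. -/
def ApartBijective {X Y : Type u} [TightApartness X] [TightApartness Y] (f : X → Y) : Prop :=
  ApartInjective f ∧ Function.Surjective f ∧
    ∃ g : Y → X, Function.LeftInverse g f ∧ Function.RightInverse g f ∧ ApartInjective g

/-- A geometry: a set of points with a tight apartness, and a set of subsets called lines. -/
class PointLineGeometry (P : Type u) extends TightApartness P where
  lines : Set (Set P)

namespace PointLineGeometry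

variable {P : Type u} [PointLineGeometry P]

/-- The point `A` lies outside `l`: it is distinct from every point of `l`. -/
def Outside (A : P) (l : Set P) : Prop := ∀ B ∈ l, A ⋕ B

/-- Distinct lines. -/
def DistinctLines (l m : Set P) : Prop :=
  (∃ A ∈ l, Outside A m) ∨ (∃ B ∈ m, Outside B l)

/-- Nonparallel lines: distinct, with a common point. -/
def Nonparallel (l m : Set P) : Prop := DistinctLines l m ∧ (l ∩ m).Nonempty

def Parallel (l m : Set P) : Prop := ¬ Nonparallel l m

/-- `l` is the line `A + B` joining the distinct points `A` and `B`. -/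
def IsJoin (l : Set P) (A B : P) : Prop := A ⋕ B ∧ l ∈ lines ∧ A ∈ l ∧ B ∈ l

/-- A dilatation: an injective, onto map `σ` with `A + B ∥ σ A + σ B` for distinct `A`, `B`. -/
def IsDilatation (σ : P → P) : Prop :=
  ApartInjective σ ∧ Function.Surjective σ ∧
    ∀ A B l m, IsJoin l A B → IsJoin m (σ A) (σ B) → Parallel l m

/-- The trace family of `σ`: the lines of the form `A + σ A`, where `A` and `σ A` are distinct. -/
def traces (σ : P → P) : Set (Set P) := {l | ∃ A, IsJoin l A (σ A)}

/-- A translation: a dilatation any two traces of which are parallel. -/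
def IsTranslation (τ : P → P) : Prop :=
  IsDilatation τ ∧ ∀ l ∈ traces τ, ∀ m ∈ traces τ, Parallel l m

/-- Distinct pencils of lines: lines of the one are nonparallel to lines of the other. -/
def DistinctPencils (π₁ π₂ : Set (Set P)) : Prop := ∃ l ∈ π₁, ∃ m ∈ π₂, Nonparallel l m

end PointLineGeometry

open PointLineGeometry in
/-- A constructive Desarguesian plane: a geometry with the axioms of groups G, L and K. -/
class DesarguesianPlane (P : Type u) extends PointLineGeometry P where
  /-- There is a unique line through two distinct points. -/
  axiomG1 : ∀ A B : P, A ⋕ B → ∃! l : Set P, l ∈ lines ∧ A ∈ l ∧ B ∈ l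
  /-- The parallel postulate. -/
  axiomG2 : ∀ (A : P), ∀ l ∈ lines, ∃! m : Set P, m ∈ lines ∧ A ∈ m ∧ Parallel m l
  /-- There are three non-collinear points. -/
  axiomG3 : ∃ A B C : P, A ⋕ B ∧ A ⋕ C ∧ B ⋕ C ∧ ∃ l, IsJoin l A B ∧ Outside C l
  /-- A point distinct from the intersection of nonparallel lines is outside one of them. -/
  axiomL1 : ∀ l ∈ lines, ∀ m ∈ lines, Nonparallel l m → ∀ A ∈ l ∩ m, ∀ B : P, B ⋕ A →
    Outside B l ∨ Outside B m
  /-- A line is nonparallel to one of two given nonparallel lines. -/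
  axiomL2 : ∀ l ∈ lines, ∀ m ∈ lines, Nonparallel l m → ∀ n ∈ lines,
    Nonparallel n l ∨ Nonparallel n m
  /-- Any point is carried to any point by a translation. -/
  axiomK1 : ∀ A B : P, ∃ τ : P → P, IsTranslation τ ∧ τ A = B
  /-- If `B`, `C` are collinear with `A` and distinct from `A`, a dilatation with fixed point `A`
  carries `B` to `C`. -/
  axiomK2 : ∀ A B C : P, (∃ l ∈ lines, A ∈ l ∧ B ∈ l ∧ C ∈ l) → B ⋕ A → C ⋕ A →
    ∃ σ : P → P, IsDilatation σ ∧ σ A = A ∧ σ B = C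

namespace DesarguesianPlane

open PointLineGeometry

variable {P : Type u} [DesarguesianPlane P]

/-! Facts needed for the group of translations and the ring of scalars. -/

theorem apart_iff_ne {X : Type u} [TightApartness X] {x y : X} : x ⋕ y ↔ x ≠ y :=
  ⟨fun h e => TightApartness.irrefl y (e ▸ h),
    fun h => by_contra fun h' => h (TightApartness.tight h')⟩

theorem outside_iff {A : P} {l : Set P} : Outside A l ↔ A ∉ l := by
  constructor
  · exact fun h hA => TightApartness.irrefl A (h A hA)
  · intro h B hB
    rw [apart_iff_ne]
    rintro rfl
    exact h hB

theorem parallel_iff {l m : Set P} : Parallel l m ↔ ∀ X, X ∈ l → X ∈ m → l = m := by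
  unfold Parallel Nonparallel DistinctLines
  simp only [outside_iff]
  constructor
  · intro h X hl hm
    by_contra hne
    refine h ⟨?_, X, hl, hm⟩
    by_contra hc
    push Not at hc
    exact hne (Set.Subset.antisymm hc.1 hc.2)
  · rintro h ⟨hd, X, hl, hm⟩
    have := h X hl hm
    subst this
    rcases hd with ⟨A, h1, h2⟩ | ⟨A, h1, h2⟩ <;> exact h2 h1

theorem parallel_symm {l m : Set P} (h : Parallel l m) : Parallel m l :=
  parallel_iff.2 fun X h1 h2 => (parallel_iff.1 h X h2 h1).symm

theorem parallel_trans {l m n : Set P} (hl : l ∈ lines) (hm : m ∈ lines) (hn : n ∈ lines)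
    (h1 : Parallel l m) (h2 : Parallel m n) : Parallel l n :=
  parallel_iff.2 fun X hXl hXn =>
    (axiomG2 X m hm).unique ⟨hl, hXl, h1⟩ ⟨hn, hXn, parallel_symm h2⟩

theorem exists_join {A B : P} (h : A ≠ B) : ∃ l, IsJoin l A B := by
  obtain ⟨l, hl, -⟩ := axiomG1 A B (apart_iff_ne.2 h)
  exact ⟨l, apart_iff_ne.2 h, hl⟩

theorem join_unique {A B : P} {l m : Set P} (h : A ≠ B) (hl : l ∈ lines) (hm : m ∈ lines)
    (hAl : A ∈ l) (hBl : B ∈ l) (hAm : A ∈ m) (hBm : B ∈ m) : l = m :=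
  (axiomG1 A B (apart_iff_ne.2 h)).unique ⟨hl, hAl, hBl⟩ ⟨hm, hAm, hBm⟩

theorem exists_notMem {l : Set P} (hl : l ∈ lines) : ∃ A, A ∉ l := by
  obtain ⟨A, B, C, hAB, -, -, m, hm, hC⟩ := axiomG3 (P := P)
  rw [outside_iff] at hC
  by_contra h
  push Not at h
  have := join_unique (apart_iff_ne.1 hAB) hl hm.2.1 (h A) (h B) hm.2.2.1 hm.2.2.2
  exact hC (this ▸ h C)

theorem _root_.PointLineGeometry.IsDilatation.injective {σ : P → P} (h : IsDilatation σ) : Function.Injective σ := by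
  intro A B hAB
  by_contra hne
  exact apart_iff_ne.1 (h.1 A B (apart_iff_ne.2 hne)) hAB

theorem _root_.PointLineGeometry.IsDilatation.mem {σ : P → P} (h : IsDilatation σ) {A B : P} {l m : Set P}
    (hm : IsJoin m A B) (hl : l ∈ lines) (hp : Parallel m l) (hA : σ A ∈ l) : σ B ∈ l := by
  obtain ⟨n, hn⟩ := exists_join (h.injective.ne (apart_iff_ne.1 hm.1))
  have h1 := parallel_trans hn.2.1 hm.2.1 hl (parallel_symm (h.2.2 A B m n hm hn)) hp
  have := parallel_iff.1 h1 (σ A) hn.2.2.1 hA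
  exact this ▸ hn.2.2.2

theorem parallel_refl (l : Set P) : Parallel l l := parallel_iff.2 fun _ _ _ => rfl

theorem isDilatation_id : IsDilatation (id : P → P) :=
  ⟨fun _ _ h => h, Function.surjective_id, fun _ _ l _ hl hm =>
    join_unique (apart_iff_ne.1 hl.1) hl.2.1 hm.2.1 hl.2.2.1 hl.2.2.2 hm.2.2.1 hm.2.2.2 ▸
      parallel_refl l⟩

theorem _root_.PointLineGeometry.IsDilatation.comp {σ ρ : P → P} (hσ : IsDilatation σ) (hρ : IsDilatation ρ) :
    IsDilatation (σ ∘ ρ) := by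
  refine ⟨fun A B h => hσ.1 _ _ (hρ.1 _ _ h), hσ.2.1.comp hρ.2.1, fun A B l m hl hm => ?_⟩
  obtain ⟨n, hn⟩ := exists_join (hρ.injective.ne (apart_iff_ne.1 hl.1))
  exact parallel_trans hl.2.1 hn.2.1 hm.2.1 (hρ.2.2 A B l n hl hn) (hσ.2.2 _ _ n m hn hm)

theorem _root_.PointLineGeometry.IsDilatation.inverse {σ ρ : P → P} (hσ : IsDilatation σ) (h : ∀ A, σ (ρ A) = A) :
    IsDilatation ρ := by
  have h' : ∀ A, ρ (σ A) = A := fun A => hσ.injective (h (σ A))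
  refine ⟨fun A B hAB => ?_, fun A => ⟨σ A, h' A⟩, fun A B l m hl hm => ?_⟩
  · rw [apart_iff_ne] at hAB ⊢
    intro he
    exact hAB (by rw [← h A, ← h B, he])
  · exact parallel_symm (hσ.2.2 _ _ m l hm (by simpa only [h] using hl))

/-- A dilatation preserves its traces. -/
theorem _root_.PointLineGeometry.IsDilatation.mem_trace {σ : P → P} (h : IsDilatation σ) {l : Set P} (hl : l ∈ traces σ)
    {B : P} (hB : B ∈ l) : σ B ∈ l := by
  obtain ⟨A, hA⟩ := hl
  by_cases hAB : A = B
  · exact hAB ▸ hA.2.2.2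
  · exact h.mem ⟨apart_iff_ne.2 hAB, hA.2.1, hA.2.2.1, hB⟩ hA.2.1 (parallel_refl l) hA.2.2.2

theorem _root_.PointLineGeometry.IsDilatation.fixed_of_notMem {σ : P → P} (h : IsDilatation σ) {A B C : P} {l : Set P}
    (hl : IsJoin l A B) (hA : σ A = A) (hB : σ B = B) (hC : C ∉ l) : σ C = C := by
  have hAC : A ≠ C := fun e => hC (e ▸ hl.2.2.1)
  have hBC : B ≠ C := fun e => hC (e ▸ hl.2.2.2)
  obtain ⟨m, hm⟩ := exists_join hAC
  obtain ⟨n, hn⟩ := exists_join hBC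
  have h1 : σ C ∈ m := h.mem hm hm.2.1 (parallel_refl m) (hA.symm ▸ hm.2.2.1)
  have h2 : σ C ∈ n := h.mem hn hn.2.1 (parallel_refl n) (hB.symm ▸ hn.2.2.1)
  by_contra hne
  have hmn := join_unique hne hm.2.1 hn.2.1 h1 hm.2.2.2 h2 hn.2.2.2
  have := join_unique (apart_iff_ne.1 hl.1) hm.2.1 hl.2.1 hm.2.2.1 (hmn ▸ hn.2.2.1)
    hl.2.2.1 hl.2.2.2
  exact hC (this ▸ hm.2.2.2)

/-- A dilatation with two distinct fixed points is the identity. -/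
theorem _root_.PointLineGeometry.IsDilatation.eq_id {σ : P → P} (h : IsDilatation σ) {A B : P} (hne : A ≠ B)
    (hA : σ A = A) (hB : σ B = B) : σ = id := by
  funext C
  obtain ⟨l, hl⟩ := exists_join hne
  by_cases hC : C ∈ l
  · obtain ⟨S, hS⟩ := exists_notMem hl.2.1
    have hSf := h.fixed_of_notMem hl hA hB hS
    by_cases hCA : C = A
    · exact hCA ▸ hA
    · obtain ⟨m, hm⟩ := exists_join (A := A) (B := S) (fun e => hS (e ▸ hl.2.2.1))
      refine h.fixed_of_notMem hm hA hSf fun hCm => hS ?_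
      exact join_unique hCA hm.2.1 hl.2.1 hCm hm.2.2.1 hC hl.2.2.1 ▸ hm.2.2.2
  · exact h.fixed_of_notMem hl hA hB hC

/-- A translation with a fixed point is the identity. -/
theorem _root_.PointLineGeometry.IsTranslation.eq_id {τ : P → P} (h : IsTranslation τ) {A : P} (hA : τ A = A) :
    τ = id := by
  by_contra hne
  have key : ∀ B, τ B ≠ B → ∀ l, IsJoin l B (τ B) → A ∈ l := by
    intro B hB l hl
    have hAB : A ≠ B := fun e => hB (e ▸ hA)
    obtain ⟨m, hm⟩ := exists_join hAB
    have h1 : τ B ∈ m := h.1.mem hm hm.2.1 (parallel_refl m) (hA.symm ▸ hm.2.2.1)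
    exact join_unique hB.symm hm.2.1 hl.2.1 hm.2.2.2 h1 hl.2.2.1 hl.2.2.2 ▸ hm.2.2.1
  obtain ⟨B, hB⟩ := Function.ne_iff.1 hne
  obtain ⟨l, hl⟩ := exists_join (Ne.symm hB)
  obtain ⟨S, hS⟩ := exists_notMem hl.2.1
  have hAl := key B hB l hl
  have hSS : τ S ≠ S := fun e => hne (h.1.eq_id (A := A) (B := S) (fun e' => hS (e' ▸ hAl)) hA e)
  obtain ⟨m, hm⟩ := exists_join hSS.symm
  have := parallel_iff.1 (h.2 l ⟨B, hl⟩ m ⟨S, hm⟩) A hAl (key S hSS m hm)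
  exact hS (this ▸ hm.2.2.1)

theorem _root_.PointLineGeometry.IsDilatation.isTranslation {τ : P → P} (h : IsDilatation τ)
    (hfix : ∀ A, τ A = A → τ = id) : IsTranslation τ := by
  refine ⟨h, fun l hl m hm => parallel_iff.2 fun X hXl hXm => ?_⟩
  by_contra hlm
  obtain ⟨A, hA⟩ := id hl
  obtain ⟨B, hB⟩ := id hm
  have hX : τ X = X := by
    by_contra hX
    exact hlm (join_unique hX hA.2.1 hB.2.1 (h.mem_trace hl hXl) hXl (h.mem_trace hm hXm) hXm)
  exact apart_iff_ne.1 hA.1 (by rw [hfix X hX]; rfl)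

theorem _root_.PointLineGeometry.IsTranslation.ne {τ : P → P} (h : IsTranslation τ) (hne : τ ≠ id) (A : P) : A ≠ τ A :=
  fun e => hne (h.eq_id e.symm)

theorem _root_.PointLineGeometry.IsTranslation.inverse {τ ρ : P → P} (hτ : IsTranslation τ) (h : ∀ A, τ (ρ A) = A) :
    IsTranslation ρ := by
  refine (hτ.1.inverse h).isTranslation fun A hA => ?_
  have : τ = id := hτ.eq_id (A := A) (by have := h A; rwa [hA] at this)
  funext B
  have h2 := h B
  rwa [this] at h2

/-- A line parallel to a trace of a translation is preserved. -/
theorem _root_.PointLineGeometry.IsTranslation.mem_of_parallel {τ ρ : P → P} (hτ : IsTranslation τ)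
    (hsub : traces ρ ⊆ traces τ) {l m : Set P} (hl : l ∈ traces τ) (hm : m ∈ lines)
    (hp : Parallel l m) {A : P} (hA : A ∈ m) : ρ A ∈ m := by
  by_cases he : A = ρ A
  · exact he ▸ hA
  · obtain ⟨n, hn⟩ := exists_join he
    have hll : l ∈ lines := by
      obtain ⟨B, hB⟩ := hl
      exact hB.2.1
    have h1 := parallel_trans hn.2.1 hll hm (hτ.2 n (hsub ⟨A, hn⟩) l hl) hp
    exact parallel_iff.1 h1 A hn.2.2.1 hA ▸ hn.2.2.2

/-- A translation is determined by the image of a single point. -/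
theorem _root_.PointLineGeometry.IsTranslation.eq_of_apply {τ ρ : P → P} (hτ : IsTranslation τ) (hρ : IsTranslation ρ)
    {A : P} (h : τ A = ρ A) : τ = ρ := by
  by_cases hA : A = τ A
  · rw [hτ.eq_id hA.symm, hρ.eq_id (h ▸ hA.symm)]
  obtain ⟨l, hl⟩ := exists_join hA
  obtain ⟨B, hB⟩ := exists_notMem hl.2.1
  obtain ⟨m, hm⟩ := exists_join (A := A) (B := B) (fun e => hB (e ▸ hl.2.2.1))
  obtain ⟨l', ⟨hl', hBl', hll'⟩, -⟩ := axiomG2 B l hl.2.1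
  obtain ⟨m', ⟨hm', hAm', hmm'⟩, -⟩ := axiomG2 (τ A) m hm.2.1
  have e1 : τ B ∈ l' := hτ.mem_of_parallel subset_rfl ⟨A, hl⟩ hl' (parallel_symm hll') hBl'
  have e2 : ρ B ∈ l' := hρ.mem_of_parallel subset_rfl ⟨A, h ▸ hl⟩ hl' (parallel_symm hll') hBl'
  have e3 : τ B ∈ m' := hτ.1.mem hm hm' (parallel_symm hmm') hAm'
  have e4 : ρ B ∈ m' := hρ.1.mem hm hm' (parallel_symm hmm') (h ▸ hAm')
  have eB : τ B = ρ B := by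
    by_contra hne
    have hlm := join_unique hne hl' hm' e1 e2 e3 e4
    subst hlm
    have := parallel_trans hl.2.1 hl' hm.2.1 (parallel_symm hll') hmm'
    exact hB (parallel_iff.1 this A hl.2.2.1 hm.2.2.1 ▸ hm.2.2.2)
  have hinv : ∀ X, ρ (Function.surjInv hρ.1.2.1 X) = X := Function.surjInv_eq hρ.1.2.1
  have hinv' : ∀ X, Function.surjInv hρ.1.2.1 (ρ X) = X := fun X => hρ.1.injective (hinv _)
  have hid := ((hρ.1.inverse hinv).comp hτ.1).eq_id (apart_iff_ne.1 hm.1)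
    (by simp only [Function.comp, h, hinv']) (by simp only [Function.comp, eB, hinv'])
  funext X
  have := congrArg ρ (congrFun hid X)
  simpa only [Function.comp, hinv, id_eq] using this

theorem _root_.PointLineGeometry.IsTranslation.comp {τ ρ : P → P} (hτ : IsTranslation τ) (hρ : IsTranslation ρ) :
    IsTranslation (τ ∘ ρ) := by
  refine (hτ.1.comp hρ.1).isTranslation fun A hA => ?_
  have hinv : ∀ X, τ (Function.surjInv hτ.1.2.1 X) = X := Function.surjInv_eq hτ.1.2.1
  have : ρ = Function.surjInv hτ.1.2.1 :=
    hρ.eq_of_apply (hτ.inverse hinv) (A := A) (hτ.1.injective (by rw [hinv]; exact hA))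
  funext X
  rw [this]
  exact hinv X

theorem isTranslation_id : IsTranslation (id : P → P) :=
  isDilatation_id.isTranslation fun _ _ => rfl

variable (P) in
/-- The translations of the plane. -/
def Translation : Type u := {τ : P → P // IsTranslation τ}

namespace Translation

instance : CoeFun (Translation P) (fun _ => P → P) := ⟨Subtype.val⟩

/-- Inequality of translations is their inequality as maps of points. -/
instance : TightApartness (Translation P) where
  apart τ ρ := τ.val ⋕ ρ.val
  irrefl τ := TightApartness.irrefl τ.val
  symm := TightApartness.symm
  cotrans h κ := TightApartness.cotrans h κ.val
  tight h := Subtype.ext (TightApartness.tight h)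

/-- The product of translations is their composition. -/
instance : Mul (Translation P) := ⟨fun τ ρ => ⟨τ.val ∘ ρ.val, τ.property.comp ρ.property⟩⟩

instance : One (Translation P) := ⟨⟨id, isTranslation_id⟩⟩

noncomputable instance : Inv (Translation P) :=
  ⟨fun τ => ⟨Function.surjInv τ.property.1.2.1,
    τ.property.inverse (Function.surjInv_eq τ.property.1.2.1)⟩⟩

theorem mul_apply (τ ρ : Translation P) (A : P) : (τ * ρ) A = τ (ρ A) := rfl

theorem one_apply (A : P) : (1 : Translation P) A = A := rfl

theorem apply_inv (τ : Translation P) (A : P) : τ (τ⁻¹ A) = A :=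
  Function.surjInv_eq τ.property.1.2.1 A

theorem eq_of_apply {τ ρ : Translation P} (A : P) (h : τ A = ρ A) : τ = ρ :=
  Subtype.ext (τ.property.eq_of_apply ρ.property h)

noncomputable instance : Group (Translation P) where
  mul_assoc _ _ _ := rfl
  one_mul _ := rfl
  mul_one _ := rfl
  inv_mul_cancel τ := Subtype.ext (funext fun A => τ.property.1.injective (apply_inv τ (τ A)))

theorem ne_apply {τ : Translation P} (h : τ ≠ 1) (A : P) : A ≠ τ A :=
  τ.property.ne (fun e => h (Subtype.ext e)) A

theorem exists_trace {τ : Translation P} (h : τ ≠ 1) (A : P) :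
    ∃ l, IsJoin l A (τ A) ∧ l ∈ traces τ := by
  obtain ⟨l, hl⟩ := exists_join (ne_apply h A)
  exact ⟨l, hl, A, hl⟩

theorem ne_one_of_mem_traces {τ : Translation P} {l : Set P} (h : l ∈ traces τ) : τ ≠ 1 := by
  rintro rfl
  obtain ⟨A, hA⟩ := h
  exact TightApartness.irrefl A hA.1

theorem mem_lines_of_mem_traces {τ : P → P} {l : Set P} (h : l ∈ traces τ) : l ∈ lines := by
  obtain ⟨A, hA⟩ := h
  exact hA.2.1

/-- Translations without common trace commute. -/
theorem commute_of_disjoint {τ ρ : Translation P} (h : ∀ l ∈ traces τ, l ∉ traces ρ) :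
    τ * ρ = ρ * τ := by
  by_cases hτ : τ = 1
  · rw [hτ, one_mul, mul_one]
  by_cases hρ : ρ = 1
  · rw [hρ, one_mul, mul_one]
  obtain ⟨A, -⟩ := axiomG3 (P := P)
  apply eq_of_apply A
  rw [mul_apply, mul_apply]
  obtain ⟨l, hl, hlt⟩ := exists_trace hτ A
  obtain ⟨m, hm, hmt⟩ := exists_trace hρ A
  obtain ⟨l', hl', hlt'⟩ := exists_trace hτ (ρ A)
  obtain ⟨m', hm', hmt'⟩ := exists_trace hρ (τ A)
  have e1 : τ (ρ A) ∈ m' :=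
    τ.property.1.mem hm hm'.2.1 (ρ.property.2 m hmt m' hmt') hm'.2.2.1
  have e2 : ρ (τ A) ∈ l' :=
    ρ.property.1.mem hl hl'.2.1 (τ.property.2 l hlt l' hlt') hl'.2.2.1
  by_contra hne
  have := join_unique hne hl'.2.1 hm'.2.1 hl'.2.2.2 e2 e1 hm'.2.2.2
  exact h l' hlt' (this ▸ hmt')

/-- Traces of a product of translations with traces among those of a given one. -/
theorem traces_mul_subset {τ ρ κ : Translation P} (hρ : traces ρ ⊆ traces τ)
    (hκ : traces κ ⊆ traces τ) : traces (ρ * κ : Translation P) ⊆ traces τ := by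
  intro l hl
  have hτ : τ ≠ 1 := by
    intro he
    have h1 : ∀ σ : Translation P, traces σ ⊆ traces τ → σ = 1 := by
      intro σ hσ
      by_contra hne
      obtain ⟨A, -⟩ := axiomG3 (P := P)
      obtain ⟨m, -, hm⟩ := exists_trace hne A
      exact ne_one_of_mem_traces (hσ hm) he
    exact ne_one_of_mem_traces hl (by rw [h1 ρ hρ, h1 κ hκ, one_mul])
  obtain ⟨A, hA⟩ := hl
  obtain ⟨m, hm, hmt⟩ := exists_trace hτ A
  have h1 : κ A ∈ m :=
    τ.property.mem_of_parallel hκ hmt hm.2.1 (parallel_refl m) hm.2.2.1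
  have h2 : ρ (κ A) ∈ m :=
    τ.property.mem_of_parallel hρ hmt hm.2.1 (parallel_refl m) h1
  exact join_unique (apart_iff_ne.1 hA.1) hm.2.1 hA.2.1 hm.2.2.1 h2 hA.2.2.1 hA.2.2.2 ▸ hmt

theorem traces_inv_subset (τ : Translation P) : traces (τ⁻¹ : Translation P) ⊆ traces τ := by
  rintro l ⟨A, hA⟩
  refine ⟨τ⁻¹ A, ?_⟩
  rw [apply_inv]
  exact ⟨TightApartness.symm hA.1, hA.2.1, hA.2.2.2, hA.2.2.1⟩

/-- A translation sharing a trace with `τ` has all its traces among those of `τ`. -/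
theorem traces_subset_of_common {τ ρ : Translation P} {l : Set P} (h1 : l ∈ traces τ)
    (h2 : l ∈ traces ρ) : traces ρ ⊆ traces τ := by
  rintro m ⟨A, hA⟩
  obtain ⟨n, hn, hnt⟩ := exists_trace (ne_one_of_mem_traces h1) A
  have hl := mem_lines_of_mem_traces h1
  have := parallel_trans hn.2.1 hl hA.2.1 (τ.property.2 n hnt l h1) (ρ.property.2 l h2 m ⟨A, hA⟩)
  exact parallel_iff.1 this A hn.2.2.1 hA.2.2.1 ▸ hnt

protected theorem mul_comm (τ ρ : Translation P) : τ * ρ = ρ * τ := by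
  by_cases h : ∀ l ∈ traces τ, l ∉ traces ρ
  · exact commute_of_disjoint h
  push Not at h
  obtain ⟨l, hlτ, hlρ⟩ := h
  have hτρ := traces_subset_of_common hlτ hlρ
  obtain ⟨A, hA⟩ := id hlτ
  obtain ⟨B, hB⟩ := exists_notMem hA.2.1
  obtain ⟨κ, hκ, hκA⟩ := axiomK1 A B
  let κ' : Translation P := ⟨κ, hκ⟩
  have hsub : ¬ traces κ' ⊆ traces τ := by
    intro hs
    have : κ A ∈ l := τ.property.mem_of_parallel hs hlτ hA.2.1 (parallel_refl l) hA.2.2.1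
    exact hB (hκA ▸ this)
  have c1 : τ * κ' = κ' * τ :=
    commute_of_disjoint fun n h1 h2 => hsub (traces_subset_of_common h1 h2)
  have c2 : τ * (ρ * κ') = (ρ * κ') * τ := by
    refine commute_of_disjoint fun n h1 h2 => hsub ?_
    have h3 := traces_subset_of_common h1 h2
    have h4 := traces_mul_subset ((traces_inv_subset ρ).trans hτρ) h3
    rwa [inv_mul_cancel_left] at h4
  have : (τ * ρ) * κ' = (ρ * τ) * κ' := by
    rw [mul_assoc, c2, mul_assoc, ← c1, mul_assoc]
  exact mul_right_cancel this

/-- The translations form a commutative group. -/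
noncomputable instance : CommGroup (Translation P) where
  mul_comm := Translation.mul_comm

/-- Different directions: the trace pencils are distinct. -/
def DifferentDirections (τ ρ : Translation P) : Prop := DistinctPencils (traces τ) (traces ρ)

/-- There is exactly one translation carrying `A` to `B`. -/
theorem existsUnique_apply (A B : P) : ∃! τ : Translation P, τ A = B := by
  obtain ⟨τ, hτ, h⟩ := axiomK1 A B
  exact ⟨⟨τ, hτ⟩, h, fun ρ hρ => eq_of_apply A (hρ.trans h.symm)⟩

/-- The translation carrying `A` to `B`. -/
noncomputable def between (A B : P) : Translation P := (existsUnique_apply A B).choose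

theorem between_apply (A B : P) : between A B A = B := (existsUnique_apply A B).choose_spec.1

end Translation

variable (P) in
/-- A trace-preserving homomorphism of the translation group. -/
@[ext]
structure TraceHom : Type u where
  toFun : Translation P → Translation P
  map_mul' : ∀ τ ρ, toFun (τ * ρ) = toFun τ * toFun ρ
  traces_subset' : ∀ τ, traces (toFun τ) ⊆ traces τ

namespace TraceHom

/-- Exponential notation: `τ ^ α` is the image of `τ` under `α`. -/
instance : Pow (Translation P) (TraceHom P) := ⟨fun τ α => α.toFun τ⟩

/-- Inequality of scalars is their inequality as maps of translations. -/
instance : TightApartness (TraceHom P) where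
  apart α β := α.toFun ⋕ β.toFun
  irrefl α := TightApartness.irrefl α.toFun
  symm := TightApartness.symm
  cotrans h γ := TightApartness.cotrans h γ.toFun
  tight h := TraceHom.ext (TightApartness.tight h)

theorem ext_pow {α β : TraceHom P} (h : ∀ τ : Translation P, τ ^ α = τ ^ β) : α = β :=
  TraceHom.ext (funext h)

theorem mul_pow (τ ρ : Translation P) (α : TraceHom P) : (τ * ρ) ^ α = τ ^ α * ρ ^ α :=
  α.map_mul' τ ρ

instance : Zero (TraceHom P) :=
  ⟨⟨fun _ => 1, fun _ _ => (one_mul 1).symm,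
    fun _ _ hl => absurd rfl (Translation.ne_one_of_mem_traces hl)⟩⟩

instance : One (TraceHom P) := ⟨⟨id, fun _ _ => rfl, fun _ => subset_rfl⟩⟩

/-- `τ ^ (α + β) = τ ^ α * τ ^ β`. -/
instance : Add (TraceHom P) :=
  ⟨fun α β => ⟨fun τ => τ ^ α * τ ^ β,
    fun τ ρ => by rw [mul_pow, mul_pow, mul_mul_mul_comm],
    fun τ => Translation.traces_mul_subset (α.traces_subset' τ) (β.traces_subset' τ)⟩⟩

/-- `τ ^ (α * β) = (τ ^ β) ^ α`. -/
instance : Mul (TraceHom P) :=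
  ⟨fun α β => ⟨fun τ => (τ ^ β) ^ α, fun τ ρ => by rw [mul_pow, mul_pow],
    fun τ => (α.traces_subset' _).trans (β.traces_subset' τ)⟩⟩

noncomputable instance : Neg (TraceHom P) :=
  ⟨fun α => ⟨fun τ => (τ ^ α)⁻¹, fun τ ρ => by rw [mul_pow, mul_inv],
    fun τ => (Translation.traces_inv_subset _).trans (α.traces_subset' τ)⟩⟩

theorem pow_zero (τ : Translation P) : τ ^ (0 : TraceHom P) = 1 := rfl

theorem pow_one (τ : Translation P) : τ ^ (1 : TraceHom P) = τ := rfl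

theorem pow_add (τ : Translation P) (α β : TraceHom P) : τ ^ (α + β) = τ ^ α * τ ^ β := rfl

theorem pow_mul (τ : Translation P) (α β : TraceHom P) : τ ^ (α * β) = (τ ^ β) ^ α := rfl

theorem pow_neg (τ : Translation P) (α : TraceHom P) : τ ^ (-α) = (τ ^ α)⁻¹ := rfl

theorem one_pow (α : TraceHom P) : (1 : Translation P) ^ α = 1 := by
  have h := mul_pow 1 1 α
  rw [mul_one] at h
  exact left_eq_mul.1 h

/-- The trace-preserving homomorphisms form a ring with identity. -/
noncomputable instance : Ring (TraceHom P) where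
  add_assoc α β γ := ext_pow fun τ => by simp only [pow_add, mul_assoc]
  zero_add α := ext_pow fun τ => by rw [pow_add, pow_zero, one_mul]
  add_zero α := ext_pow fun τ => by rw [pow_add, pow_zero, mul_one]
  add_comm α β := ext_pow fun τ => by rw [pow_add, pow_add, mul_comm]
  neg_add_cancel α := ext_pow fun τ => by rw [pow_add, pow_neg, inv_mul_cancel, pow_zero]
  mul_assoc α β γ := rfl
  one_mul α := rfl
  mul_one α := rfl
  zero_mul α := rfl
  mul_zero α := ext_pow fun τ => by rw [pow_mul, pow_zero, one_pow]
  left_distrib α β γ := ext_pow fun τ => by simp only [pow_add, pow_mul, mul_pow]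
  right_distrib α β γ := rfl
  nsmul := nsmulRec
  zsmul := zsmulRec

end TraceHom

/-- The set of pairs `(α + t γ, β + t δ)`, where `t` runs over the scalars. -/
def paramLine (α β γ δ : TraceHom P) : Set (TraceHom P × TraceHom P) :=
  {c | ∃ t : TraceHom P, c = (α + t * γ, β + t * δ)}

end DesarguesianPlane

open PointLineGeometry DesarguesianPlane

/-! ### Points on a line -/

namespace DesarguesianPlane

open PointLineGeometry

variable {P : Type u} [DesarguesianPlane P]

/-! The translations act simply transitively on the points, so `A ↦ between O A` identifies the
plane with the group `T`. The theorem then says that `T`, written additively, is a free left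
`k`-module with basis `τ₁`, `τ₂`, and that lines are cosets of the cyclic submodules generated by
nontrivial translations.

The trace families of two translations are either disjoint or nested, and different directions make
them disjoint. The scalar multiples of `τ ≠ 1` are exactly the translations whose traces are traces
of `τ`: axiom K2 supplies a dilatation, and conjugation by it is the required scalar
(`exists_pow_eq`). Generation is then the parallelogram construction (`exists_eq_pow_mul_pow`).
Independence holds because only the identity has its traces in two disjoint families, and a scalar
that kills one nontrivial translation kills all (`eq_zero_of_pow_eq_one`).

The argument is classical: tight apartness becomes `≠` (`apart_iff_ne`) and `Outside` becomes `∉`,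
so the claims about apartness follow from injectivity of the coordinate map. -/

theorem line_nonempty {l : Set P} (hl : l ∈ lines) : l.Nonempty := by
  by_contra h
  obtain ⟨A, B, C, hAB, hAC, -, m, hm, hC⟩ := axiomG3 (P := P)
  obtain ⟨n, hn⟩ := exists_join (apart_iff_ne.1 hAC)
  -- Every line is vacuously parallel to an empty one, so two different lines through `A` would
  -- violate uniqueness in G2.
  have hp : ∀ k : Set P, Parallel k l := fun k => parallel_iff.2 fun X _ hX => absurd ⟨X, hX⟩ h
  have := (axiomG2 A l hl).unique ⟨hm.2.1, hm.2.2.1, hp m⟩ ⟨hn.2.1, hn.2.2.1, hp n⟩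
  exact outside_iff.1 hC (this ▸ hn.2.2.2)

/-- If `A` were the only point of `l`, take a second line `m` through `A` and a parallel `n` to `m`
missing `A`. Then `n` is nonparallel to neither `l` nor `m`, against L2. -/
theorem exists_mem_ne {l : Set P} (hl : l ∈ lines) {A : P} (hA : A ∈ l) : ∃ B ∈ l, B ≠ A := by
  by_contra h
  push Not at h
  obtain ⟨B, hB⟩ := exists_notMem hl
  obtain ⟨m, hm⟩ := exists_join (A := A) (B := B) (fun e => hB (e ▸ hA))
  have hlm : Nonparallel l m :=
    ⟨Or.inr ⟨B, hm.2.2.2, outside_iff.2 hB⟩, A, hA, hm.2.2.1⟩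
  obtain ⟨C, hC⟩ := exists_notMem hm.2.1
  obtain ⟨n, ⟨hn, hCn, hnm⟩, -⟩ := axiomG2 C m hm.2.1
  have hAn : A ∉ n := fun hAn => hC (parallel_iff.1 hnm A hAn hm.2.2.1 ▸ hCn)
  rcases axiomL2 l hl m hm.2.1 hlm n hn with hnl | hnm'
  · obtain ⟨X, hXn, hXl⟩ := hnl.2
    exact hAn (h X hXl ▸ hXn)
  · exact hnm hnm'

/-! ### Trace families of translations -/

namespace Translation

theorem mem_traces_of_parallel {τ : Translation P} {l m : Set P} (hl : l ∈ traces τ)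
    (hm : m ∈ lines) (hlm : Parallel l m) : m ∈ traces τ := by
  obtain ⟨A, hA⟩ := line_nonempty hm
  have hτA := τ.property.mem_of_parallel subset_rfl hl hm hlm hA
  exact ⟨A, apart_iff_ne.2 (ne_apply (ne_one_of_mem_traces hl) A), hm, hA, hτA⟩

theorem traces_one : traces (1 : Translation P) = ∅ :=
  Set.eq_empty_iff_forall_notMem.2 fun _ hl => ne_one_of_mem_traces hl rfl

theorem mem_traces {τ : Translation P} (hτ : τ ≠ 1) {l : Set P} (hl : l ∈ lines) {A : P}
    (hA : A ∈ l) (hτA : τ A ∈ l) : l ∈ traces τ :=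
  ⟨A, apart_iff_ne.2 (ne_apply hτ A), hl, hA, hτA⟩

/-- A translation moving a point along a trace of `τ` has its traces among those of `τ`. -/
theorem traces_subset_of_mem {τ ρ : Translation P} {l : Set P} (hl : l ∈ traces τ) {A : P}
    (hA : A ∈ l) (hρA : ρ A ∈ l) : traces ρ ⊆ traces τ := by
  by_cases hρ : ρ = 1
  · rw [hρ, traces_one]
    exact Set.empty_subset _
  · exact traces_subset_of_common hl (mem_traces hρ (mem_lines_of_mem_traces hl) hA hρA)

theorem exists_mem_traces {τ : Translation P} (hτ : τ ≠ 1) : ∃ l, l ∈ traces τ := by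
  obtain ⟨A, -⟩ := axiomG3 (P := P)
  obtain ⟨l, -, hl⟩ := exists_trace hτ A
  exact ⟨l, hl⟩

theorem disjoint_traces_of_not_subset {τ ρ : Translation P} (h : ¬ traces ρ ⊆ traces τ) :
    Disjoint (traces (τ : P → P)) (traces ρ) :=
  Set.disjoint_left.2 fun _ h1 h2 => h (traces_subset_of_common h1 h2)

theorem eq_one_of_traces_subset {τ ρ κ : Translation P} (hd : Disjoint (traces (τ : P → P)) (traces ρ))
    (h1 : traces κ ⊆ traces τ) (h2 : traces κ ⊆ traces ρ) : κ = 1 := by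
  by_contra hκ
  obtain ⟨l, hl⟩ := exists_mem_traces hκ
  exact Set.disjoint_left.1 hd (h1 hl) (h2 hl)

/-- A translation moving a point off a line `l` preserved by `τ` will do: a common trace would make
`l` a trace of both, and a translation preserves its own traces. -/
theorem exists_disjoint_traces (τ : Translation P) :
    ∃ ρ : Translation P, ρ ≠ 1 ∧ Disjoint (traces (τ : P → P)) (traces ρ) := by
  obtain ⟨l, hl, hsub⟩ : ∃ l ∈ (lines : Set (Set P)), ∀ A ∈ l, τ A ∈ l := by
    by_cases hτ : τ = 1
    · obtain ⟨A, B, -, -, -, -, l, hl, -⟩ := axiomG3 (P := P)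
      exact ⟨l, hl.2.1, fun A hA => hτ ▸ hA⟩
    · obtain ⟨l, hl⟩ := exists_mem_traces hτ
      exact ⟨l, mem_lines_of_mem_traces hl, fun A hA => τ.property.1.mem_trace hl hA⟩
  obtain ⟨A, hA⟩ := line_nonempty hl
  obtain ⟨B, hB⟩ := exists_notMem hl
  refine ⟨between A B, fun h => hB ?_, Set.disjoint_left.2 fun m h1 h2 => hB ?_⟩
  · rw [← between_apply A B, h]
    exact hA
  · have hlτ := mem_traces (ne_one_of_mem_traces h1) hl hA (hsub A hA)
    have := (between A B).property.1.mem_trace (traces_subset_of_common h2 h1 hlτ) hA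
    rwa [between_apply] at this

theorem DifferentDirections.disjoint_traces {τ ρ : Translation P}
    (h : DifferentDirections τ ρ) : Disjoint (traces (τ : P → P)) (traces ρ) := by
  obtain ⟨l, hl, m, hm, hlm⟩ := h
  -- A common trace would make `m` a trace of `τ`, hence parallel to `l`.
  exact Set.disjoint_left.2 fun n h1 h2 =>
    τ.property.2 l hl m (traces_subset_of_common h1 h2 hm) hlm

theorem between_eq {A B : P} {τ : Translation P} (h : τ A = B) : between A B = τ :=
  eq_of_apply A ((between_apply A B).trans h.symm)

theorem between_mul_between (A B C : P) : between B C * between A B = between A C :=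
  (between_eq (by rw [mul_apply, between_apply, between_apply])).symm

/-! ### Conjugation by dilatations, the source of scalars -/

/-- Conjugation of a translation by a dilatation. -/
noncomputable def conj (σ : P → P) (hσ : IsDilatation σ) (τ : Translation P) : Translation P :=
  ⟨σ ∘ τ ∘ Function.surjInv hσ.2.1,
    (hσ.comp (τ.property.1.comp (hσ.inverse (Function.surjInv_eq hσ.2.1)))).isTranslation
      fun A hA => by
        have h1 : τ (Function.surjInv hσ.2.1 A) = Function.surjInv hσ.2.1 A :=
          hσ.injective (hA.trans (Function.surjInv_eq hσ.2.1 A).symm)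
        have h2 := τ.property.eq_id h1
        funext B
        simp only [Function.comp, h2, id_eq, Function.surjInv_eq]⟩

theorem conj_apply {σ : P → P} (hσ : IsDilatation σ) (τ : Translation P) (A : P) :
    conj σ hσ τ (σ A) = σ (τ A) := by
  have : Function.surjInv hσ.2.1 (σ A) = A := hσ.injective (Function.surjInv_eq hσ.2.1 (σ A))
  change σ (τ (Function.surjInv hσ.2.1 (σ A))) = _
  rw [this]

theorem conj_mul {σ : P → P} (hσ : IsDilatation σ) (τ ρ : Translation P) :
    conj σ hσ (τ * ρ) = conj σ hσ τ * conj σ hσ ρ := by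
  obtain ⟨A, -⟩ := axiomG3 (P := P)
  apply eq_of_apply (σ A)
  simp only [conj_apply, mul_apply]

theorem traces_conj_subset {σ : P → P} (hσ : IsDilatation σ) (τ : Translation P) :
    traces (conj σ hσ τ) ⊆ traces τ := by
  rintro l ⟨A, hA⟩
  obtain ⟨B, rfl⟩ := hσ.2.1 A
  rw [conj_apply] at hA
  -- With `A = σ B`, the trace `l` joins `σ B` to `σ (τ B)`, so it is parallel to the trace `B + τ
  -- B` of `τ`.
  have hne : B ≠ τ B := fun e => apart_iff_ne.1 hA.1 (congrArg σ e)
  obtain ⟨m, hm⟩ := exists_join hne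
  exact mem_traces_of_parallel ⟨B, hm⟩ hA.2.1 (hσ.2.2 B (τ B) m l hm hA)

end Translation

/-! ### Scalar multiples and linear independence -/

namespace TraceHom

open Translation

theorem traces_pow_subset (τ : Translation P) (α : TraceHom P) :
    traces (τ ^ α : Translation P) ⊆ traces τ := α.traces_subset' τ

/-- A translation with its traces among those of `τ ≠ 1` is a scalar multiple of `τ`. -/
theorem exists_pow_eq {τ ρ : Translation P} (hτ : τ ≠ 1) (h : traces ρ ⊆ traces τ) :
    ∃ α : TraceHom P, τ ^ α = ρ := by
  by_cases hρ : ρ = 1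
  · exact ⟨0, hρ.symm⟩
  obtain ⟨A, -⟩ := axiomG3 (P := P)
  obtain ⟨l, hl, hlt⟩ := exists_trace hτ A
  have hρA := τ.property.mem_of_parallel h hlt hl.2.1 (parallel_refl l) hl.2.2.1
  -- Since `σ` fixes `A` and carries `τ A` to `ρ A`, the conjugate of `τ` by `σ` agrees with `ρ` at
  -- `A`. The case `ρ = 1` was split off because K2 needs `ρ A` distinct from `A`.
  obtain ⟨σ, hσ, hσA, hσB⟩ := axiomK2 A (τ A) (ρ A) ⟨l, hl.2.1, hl.2.2.1, hl.2.2.2, hρA⟩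
    (TightApartness.symm hl.1) (apart_iff_ne.2 (ne_apply hρ A).symm)
  refine ⟨⟨conj σ hσ, conj_mul hσ, traces_conj_subset hσ⟩, eq_of_apply A ?_⟩
  have := conj_apply hσ τ A
  rw [hσA, hσB] at this
  exact this

/-- As `τ ^ α = 1`, the translation `ρ ^ α = (τ * ρ) ^ α` has its traces both among those of `ρ` and
among those of `τ * ρ`. For `ρ ≠ 1` these families are disjoint, since otherwise `τ = (τ * ρ) * ρ⁻¹`
would share a trace with `ρ`. -/
theorem pow_eq_one_of_disjoint {τ ρ : Translation P} {α : TraceHom P} (h : τ ^ α = 1)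
    (hτ : τ ≠ 1) (hd : Disjoint (traces (τ : P → P)) (traces ρ)) : ρ ^ α = 1 := by
  by_cases hρ : ρ = 1
  · rw [hρ, one_pow]
  have h1 : traces (ρ ^ α : Translation P) ⊆ traces (τ * ρ : Translation P) := by
    have := traces_pow_subset (τ * ρ) α
    rwa [mul_pow, h, one_mul] at this
  refine eq_one_of_traces_subset (disjoint_traces_of_not_subset fun hs => ?_) h1
    (traces_pow_subset ρ α)
  have hs' : traces τ ⊆ traces (τ * ρ : Translation P) := by
    have := traces_mul_subset subset_rfl ((traces_inv_subset ρ).trans hs)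
    rwa [mul_inv_cancel_right] at this
  obtain ⟨l, hl⟩ := exists_mem_traces hρ
  obtain ⟨m, hm⟩ := exists_mem_traces hτ
  exact Set.disjoint_left.1 hd hm (traces_subset_of_common hl (hs hl) (hs' hm))

/-- A scalar annihilating a translation `τ ≠ 1` vanishes. -/
theorem eq_zero_of_pow_eq_one {τ : Translation P} {α : TraceHom P} (hτ : τ ≠ 1)
    (h : τ ^ α = 1) : α = 0 := by
  refine ext_pow fun ρ => ?_
  rw [pow_zero]
  by_cases hs : traces ρ ⊆ traces τ
  -- In the direction of `τ` itself the previous lemma does not apply directly; it is used twice,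
  -- passing from `τ` to `κ` and back to `ρ`.
  · obtain ⟨κ, hκ, hd⟩ := exists_disjoint_traces τ
    exact pow_eq_one_of_disjoint (pow_eq_one_of_disjoint h hτ hd) hκ
      (hd.symm.mono_right hs)
  · exact pow_eq_one_of_disjoint h hτ (disjoint_traces_of_not_subset hs)

theorem pow_sub (τ : Translation P) (α β : TraceHom P) : τ ^ (α - β) = τ ^ α * (τ ^ β)⁻¹ := by
  rw [sub_eq_add_neg, pow_add, pow_neg]

section Coordinates

variable {τ₁ τ₂ : Translation P}

/-- Two translations without common trace are linearly independent. -/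
theorem eq_zero_of_pow_mul_pow_eq_one (h₁ : τ₁ ≠ 1) (h₂ : τ₂ ≠ 1)
    (hd : Disjoint (traces (τ₁ : P → P)) (traces τ₂)) {x y : TraceHom P}
    (h : τ₁ ^ x * τ₂ ^ y = 1) : x = 0 ∧ y = 0 := by
  have hx : τ₁ ^ x = 1 := by
    -- `τ₁ ^ x` is the inverse of `τ₂ ^ y`, so its traces lie in both disjoint families.
    refine eq_one_of_traces_subset hd (traces_pow_subset τ₁ x) ?_
    rw [eq_inv_of_mul_eq_one_left h]
    exact (traces_inv_subset _).trans (traces_pow_subset τ₂ y)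
  rw [hx, one_mul] at h
  exact ⟨eq_zero_of_pow_eq_one h₁ hx, eq_zero_of_pow_eq_one h₂ h⟩

theorem pow_mul_pow_injective (h₁ : τ₁ ≠ 1) (h₂ : τ₂ ≠ 1)
    (hd : Disjoint (traces (τ₁ : P → P)) (traces τ₂)) :
    Function.Injective fun c : TraceHom P × TraceHom P => τ₁ ^ c.1 * τ₂ ^ c.2 := by
  intro c d h
  have key : τ₁ ^ (c.1 - d.1) * τ₂ ^ (c.2 - d.2) = 1 := by
    rw [pow_sub, pow_sub, mul_mul_mul_comm, ← mul_inv, mul_inv_eq_one]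
    exact h
  have := eq_zero_of_pow_mul_pow_eq_one h₁ h₂ hd key
  exact Prod.ext (sub_eq_zero.1 this.1) (sub_eq_zero.1 this.2)

/-- Two translations with different directions generate the translation group over the scalars. -/
theorem exists_eq_pow_mul_pow (hdir : DifferentDirections τ₁ τ₂) (ρ : Translation P) :
    ∃ x y : TraceHom P, ρ = τ₁ ^ x * τ₂ ^ y := by
  obtain ⟨A, -⟩ := axiomG3 (P := P)
  obtain ⟨l, hl, m, hm, hlm⟩ := hdir
  have hll := mem_lines_of_mem_traces hl
  have hmm := mem_lines_of_mem_traces hm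
  obtain ⟨l', ⟨hl', hAl', hp⟩, -⟩ := axiomG2 A l hll
  obtain ⟨m', ⟨hm', hBm', hq⟩, -⟩ := axiomG2 (ρ A) m hmm
  -- The parallelogram corner: `ρ` is the move from `A` to `C` in the direction of `τ₁`, followed by
  -- the move from `C` to `ρ A` in the direction of `τ₂`.
  obtain ⟨C, hCl, hCm⟩ : (l' ∩ m').Nonempty := by
    have : ¬ Parallel l' m' := fun h => parallel_trans hll hl' hmm (parallel_symm hp)
      (parallel_trans hl' hm' hmm h hq) hlm
    exact (not_not.1 this).2
  have hl₁ := mem_traces_of_parallel hl hl' (parallel_symm hp)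
  have hm₂ := mem_traces_of_parallel hm hm' (parallel_symm hq)
  obtain ⟨x, hx⟩ := exists_pow_eq (ne_one_of_mem_traces hl)
    (traces_subset_of_mem (ρ := between A C) hl₁ hAl' ((between_apply A C).symm ▸ hCl))
  obtain ⟨y, hy⟩ := exists_pow_eq (ne_one_of_mem_traces hm)
    (traces_subset_of_mem (ρ := between C (ρ A)) hm₂ hCm
      ((between_apply C (ρ A)).symm ▸ hBm'))
  refine ⟨x, y, ?_⟩
  rw [hx, hy, mul_comm, between_mul_between]
  exact (between_eq rfl).symm

end Coordinates

/-! ### Lines in coordinates -/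

/-- The points of the line through `A` with direction `τ` are the images of `A` under the scalar
multiples of `τ`. -/
theorem mem_line_iff {τ : Translation P} {A : P} {l : Set P} (hl : IsJoin l A (τ A)) (B : P) :
    B ∈ l ↔ ∃ t : TraceHom P, between A B = τ ^ t := by
  have hlt : l ∈ traces τ := ⟨A, hl⟩
  constructor
  · intro hB
    obtain ⟨t, ht⟩ := exists_pow_eq (ne_one_of_mem_traces hlt)
      (traces_subset_of_mem (ρ := between A B) hlt hl.2.2.1 ((between_apply A B).symm ▸ hB))
    exact ⟨t, ht.symm⟩
  · rintro ⟨t, ht⟩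
    have := τ.property.mem_of_parallel (traces_pow_subset τ t) hlt hl.2.1 (parallel_refl l)
      hl.2.2.1
    rwa [← ht, between_apply] at this

/-- The factors stand in the order of `between_mul_between`: the first move, from the origin to the
base point, is on the right. -/
theorem pow_mul_pow_add (τ₁ τ₂ : Translation P) (x y z w : TraceHom P) :
    τ₁ ^ (x + z) * τ₂ ^ (y + w) = (τ₁ ^ z * τ₂ ^ w) * (τ₁ ^ x * τ₂ ^ y) := by
  rw [pow_add, pow_add, mul_mul_mul_comm, mul_comm]

theorem pow_mul_pow_mul (τ₁ τ₂ : Translation P) (t z w : TraceHom P) :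
    τ₁ ^ (t * z) * τ₂ ^ (t * w) = (τ₁ ^ z * τ₂ ^ w) ^ t := by
  rw [mul_pow, pow_mul, pow_mul]

/-- A line in coordinates: the points of the line through `B` with direction
`τ₁ ^ γ * τ₂ ^ δ`. -/
theorem mem_line_iff_mem_paramLine {O B : P} {τ₁ τ₂ : Translation P}
    {coord : P → TraceHom P × TraceHom P}
    (hcoord : ∀ A c, between O A = τ₁ ^ c.1 * τ₂ ^ c.2 ↔ c = coord A)
    {γ δ : TraceHom P} {l : Set P} (hl : IsJoin l B ((τ₁ ^ γ * τ₂ ^ δ : Translation P) B)) (A : P) :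
    A ∈ l ↔ coord A ∈ paramLine (coord B).1 (coord B).2 γ δ := by
  rw [mem_line_iff hl]
  refine exists_congr fun t => ?_
  -- Both sides become equations of translations; writing `between O A` as `between B A * between O
  -- B` lets `between O B` cancel.
  rw [eq_comm (a := coord A), ← hcoord, pow_mul_pow_add, pow_mul_pow_mul,
    ← (hcoord B (coord B)).2 rfl, ← between_mul_between O B A, mul_left_inj]

end TraceHom

end DesarguesianPlane

/-! ### The coordinate map -/

theorem theorem5p6 {P : Type u} [DesarguesianPlane P] (O : P) (τ₁ τ₂ : Translation P)
    (h₁ : τ₁ ⋕ 1) (h₂ : τ₂ ⋕ 1) (hdir : Translation.DifferentDirections τ₁ τ₂) :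
    -- (a) unique coordinates
    (∀ A : P, ∃! c : TraceHom P × TraceHom P,
      Translation.between O A = τ₁ ^ c.1 * τ₂ ^ c.2) ∧
    ∃ coord : P → TraceHom P × TraceHom P,
      (∀ A : P, Translation.between O A = τ₁ ^ (coord A).1 * τ₂ ^ (coord A).2) ∧
      -- (b) the coordinate map is a bijection, and the inequality relations correspond
      ApartBijective coord ∧
      (∀ A B : P, A ⋕ B ↔ coord A ⋕ coord B) ∧
      -- (c) lines
      (∀ l : Set P, l ∈ lines → ∃ α β γ δ : TraceHom P, (γ ⋕ 0 ∨ δ ⋕ 0) ∧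
        ∀ A : P, A ∈ l ↔ coord A ∈ paramLine α β γ δ) ∧
      (∀ α β γ δ : TraceHom P, (γ ⋕ 0 ∨ δ ⋕ 0) →
        {A : P | coord A ∈ paramLine α β γ δ} ∈ (lines : Set (Set P))) ∧
      -- (d) the relation "outside"
      (∀ l : Set P, l ∈ lines → ∀ α β γ δ : TraceHom P, (γ ⋕ 0 ∨ δ ⋕ 0) →
        (∀ A : P, A ∈ l ↔ coord A ∈ paramLine α β γ δ) →
        ∀ A : P, Outside A l ↔
          ∀ t : TraceHom P, coord A ⋕ (α + t * γ, β + t * δ)) := by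
  open Translation TraceHom in
  rw [apart_iff_ne] at h₁ h₂
  have hd := hdir.disjoint_traces
  have hinj := pow_mul_pow_injective h₁ h₂ hd
  have hex : ∀ A : P, ∃ c : TraceHom P × TraceHom P, between O A = τ₁ ^ c.1 * τ₂ ^ c.2 := by
    intro A
    obtain ⟨x, y, h⟩ := exists_eq_pow_mul_pow hdir (between O A)
    exact ⟨(x, y), h⟩
  choose coord hc using hex
  have hcoord : ∀ A c, between O A = τ₁ ^ c.1 * τ₂ ^ c.2 ↔ c = coord A :=
    fun A c => ⟨fun h => hinj (h.symm.trans (hc A)), fun h => h ▸ hc A⟩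
  let point : TraceHom P × TraceHom P → P := fun c => (τ₁ ^ c.1 * τ₂ ^ c.2 : Translation P) O
  have hleft : Function.LeftInverse point coord := fun A => by
    change (τ₁ ^ (coord A).1 * τ₂ ^ (coord A).2 : Translation P) O = A
    rw [← hc, between_apply]
  have hright : Function.RightInverse point coord := fun c =>
    ((hcoord (point c) c).1 (between_eq rfl)).symm
  have hap : ∀ A B : P, A ⋕ B ↔ coord A ⋕ coord B := fun A B => by
    rw [apart_iff_ne, apart_iff_ne, hleft.injective.ne_iff]
  refine ⟨fun A => ⟨coord A, hc A, fun c => (hcoord A c).1⟩, coord, hc,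
    ⟨fun A B => (hap A B).1, hright.surjective, point, hleft, hright, fun c d h => ?_⟩, hap,
    fun l hl => ?_, fun α β γ δ h => ?_, fun l _ α β γ δ _ hl A => ?_⟩
  · rwa [hap, hright, hright]
  · obtain ⟨B, hB⟩ := line_nonempty hl
    obtain ⟨C, hC, hCB⟩ := exists_mem_ne hl hB
    obtain ⟨γ, δ, hγδ⟩ := exists_eq_pow_mul_pow hdir (between B C)
    have hj : IsJoin l B ((τ₁ ^ γ * τ₂ ^ δ : Translation P) B) := by
      rw [← hγδ, between_apply]
      exact ⟨apart_iff_ne.2 hCB.symm, hl, hB, hC⟩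
    -- The base point of the parametrization is `coord B`. If `γ` and `δ` both vanished, the
    -- translation from `B` to `C` would fix `B`.
    refine ⟨_, _, γ, δ, ?_, mem_line_iff_mem_paramLine hcoord hj⟩
    rw [apart_iff_ne, apart_iff_ne, ← not_and_or]
    rintro ⟨rfl, rfl⟩
    exact apart_iff_ne.1 hj.1 rfl
  · have hne : τ₁ ^ γ * τ₂ ^ δ ≠ 1 := fun e => by
      obtain ⟨hγ, hδ⟩ := eq_zero_of_pow_mul_pow_eq_one h₁ h₂ hd e
      exact h.elim (fun h => apart_iff_ne.1 h hγ) (fun h => apart_iff_ne.1 h hδ)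
    -- The required line is the trace, through the point with coordinates `(α, β)`, of the direction
    -- `τ₁ ^ γ * τ₂ ^ δ`, which is nontrivial by independence.
    obtain ⟨l, hl, -⟩ := exists_trace hne (point (α, β))
    convert hl.2.1 using 1
    ext A
    have := mem_line_iff_mem_paramLine hcoord hl A
    rw [hright] at this
    exact this.symm
  · rw [outside_iff, hl]
    simp only [apart_iff_ne]
    exact not_exists
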